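/- Let $\Bbbk$ be a field. For a monomial ideal $J$ in a polynomial ring $R=\Bbbk[x_1,\ldots,x_r]$ let $\mathcal G(J)$ be its set of minimal monomial generators, and for a finite set $F\subseteq\mathcal G(J)$ put $m_F=\operatorname{lcm}(F)$ (with $m_\emptyset=1$). A monomial $v$ \emph{properly divides} a monomial $w$ if $v\mid w$ and $\deg_{x_i}v<\deg_{x_i}w$ for every variable $x_i$ dividing $w$. The ideal $J$ is \emph{generic} if, whenever two distinct $v,v'\in\mathcal G(J)$ have the same positive degree in some variable, a third generator $v''\in\mathcal G(J)$ properly divides $\operatorname{lcm}(v,v')$. The \emph{Buchberger complex} $\mathfrak{Bu}(J)$ is the simplicial complex of all $F\subseteq\mathcal G(J)$ such that no $v\in\mathcal G(J)$ properly divides $m_F$; the \emph{Scarf complex} $\mathfrak{Sc}(J)$ is the simplicial complex of all $F\subseteq\mathcal G(J)$ such that $m_F\neq m_G$ for every $G\subseteq\mathcal G(J)$ with $G\ne F$. For a simplicial complex $\Delta$ of subsets of $\mathcal G(J)$, let $\mathcal F_\Delta$ be the $\mathbb N^r$-graded complex of free $R$-modules whose $i$-th module has a basis element $e_F$ in degree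 $m_F$ for each $F\in\Delta$ with $|F|=i+1$, with the homogenized simplicial differential $e_F\mapsto\sum_{v\in F}\pm\frac{m_F}{m_{F\setminus\{v\}}}e_{F\setminus\{v\}}$ and the augmentation $e_{\{v\}}\mapsto v$ (for $\Delta=\mathfrak{Bu}(J)$ it is called the Buchberger resolution, and for $\Delta=\mathfrak{Sc}(J)$ the algebraic Scarf complex, of $J$). It is a minimal free resolution of $J$ if the complex $\cdots\to\mathcal F_1\to\mathcal F_0\to J\to 0$ is exact and every differential maps $\mathcal F_{i+1}$ into $(x_1,\ldots,x_r)\mathcal F_i$. \textbf{Proposition.} Let $m>n\ge 0$ be integers, let $\mathbf u=(u_1,\ldots,u_n)$ be a vector of nonnegative integers, and let $I\subsetneq\Bbbk[x_1,\ldots,x_n]$ be a proper ideal generated by monomials dividing $\mathbf x^{\mathbf u}=x_1^{u_1}\cdots x_n^{u_n}$. Let $M$ be a monomial in the variables $x_{n+1},\ldots,x_m$ (possibly $M=1$), and let $\bar I$ be the ideal of $\Bbbk[x_1,\ldots,x_m]$ generated by $I$ and the monomials $x_1^{u_1+1}M,\ldots,x_n^{u_n+1}M$. If $I$ is generic, then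 $\mathcal F_{\mathfrak{Bu}(\bar I)}$ is a minimal free resolution of $\bar I$. Moreover, $\mathcal F_{\mathfrak{Sc}(\bar I)}$ is a minimal free resolution of $\bar I$. -/

import Mathlib

open MvPolynomial

/- Monomials of `k[x_i : i ∈ σ]` are represented by their exponent vectors `a : σ →₀ ℕ`;
divisibility of monomials is the coordinatewise order `≤` and the least common multiple is `⊔`. -/

namespace MonomialRes

/-- `MinGen(I)`: the monomials of `I` that are minimal with respect to divisibility. -/
def minGen {σ k : Type*} [Field k] (I : Ideal (MvPolynomial σ k)) : Set (σ →₀ ℕ) :=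
  {a | Minimal (fun b : σ →₀ ℕ => monomial b (1 : k) ∈ I) a}

/-- The label `m_F` of a finite set `F` of monomials: its least common multiple
(the monomial `1`, that is the exponent vector `0`, if `F` is empty). -/
noncomputable def label {σ : Type*} (F : Finset (σ →₀ ℕ)) : σ →₀ ℕ := F.sup id

/-- `a` properly (strictly) divides `b`: `a` divides `b`, and `a_i < b_i` for all `i` with
`b_i ≠ 0` while `a_i = b_i` whenever `b_i = 0`. -/
def ProperlyDivides {σ : Type*} (a b : σ →₀ ℕ) : Prop :=
  a ≤ b ∧ ∀ i, (b i ≠ 0 → a i < b i) ∧ (b i = 0 → a i = b i)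

/-- `I` is generic: whenever two distinct minimal generators have the same positive degree in some
variable, a third minimal generator strictly divides their least common multiple. -/
def IsGeneric {σ k : Type*} [Field k] (I : Ideal (MvPolynomial σ k)) : Prop :=
  ∀ a ∈ minGen I, ∀ b ∈ minGen I, a ≠ b → (∃ i, a i = b i ∧ 0 < a i) →
    ∃ c ∈ minGen I, c ≠ a ∧ c ≠ b ∧ ProperlyDivides c (a ⊔ b)

theorem label_mono {σ : Type*} {F G : Finset (σ →₀ ℕ)} (h : F ⊆ G) : label F ≤ label G :=
  Finset.sup_mono h

theorem ProperlyDivides.trans_le {σ : Type*} {a b c : σ →₀ ℕ} (h : ProperlyDivides a b)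
    (hbc : b ≤ c) : ProperlyDivides a c := by
  refine ⟨h.1.trans hbc, fun i => ⟨fun hc => ?_, fun hc => ?_⟩⟩
  · have h1 := hbc i
    by_cases hb : b i = 0
    · have h2 := (h.2 i).2 hb
      omega
    · have h2 := (h.2 i).1 hb
      omega
  · have h1 := hbc i
    have h2 := h.1 i
    omega

/-- The Buchberger complex of `I`: all sets `F` of minimal generators such that no minimal generator
properly divides `m_F`. An (abstract) simplicial complex is a lower set of finite vertex sets. -/
def buchbergerComplex {σ k : Type*} [Field k] (I : Ideal (MvPolynomial σ k)) :
    LowerSet (Finset (σ →₀ ℕ)) where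
  carrier := {F | (∀ a ∈ F, a ∈ minGen I) ∧ ∀ u ∈ minGen I, ¬ ProperlyDivides u (label F)}
  lower' := fun _ _ hGF hF =>
    ⟨fun a ha => hF.1 a (hGF ha), fun u hu h => hF.2 u hu (h.trans_le (label_mono hGF))⟩

/-- The Scarf complex of `I`: all sets `F` of minimal generators such that no other set of minimal
generators has the same least common multiple. -/
def scarfComplex {σ k : Type*} [Field k] (I : Ideal (MvPolynomial σ k)) :
    LowerSet (Finset (σ →₀ ℕ)) where
  carrier := {F | (∀ a ∈ F, a ∈ minGen I) ∧
    ∀ G : Finset (σ →₀ ℕ), (∀ a ∈ G, a ∈ minGen I) → label F = label G → F = G}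
  lower' := by
    classical
    intro F G hGF hF
    have hGF' : G ⊆ F := hGF
    refine ⟨fun a ha => hF.1 a (hGF' ha), fun H hH hlab => ?_⟩
    have key : ∀ K : Finset (σ →₀ ℕ), (∀ a ∈ K, a ∈ minGen I) → label K = label G →
        K ∪ (F \ G) = F := by
      intro K hK hlK
      refine (hF.2 _ ?_ ?_).symm
      · intro a ha
        rcases Finset.mem_union.1 ha with h | h
        · exact hK a h
        · exact hF.1 a (Finset.mem_sdiff.1 h).1
      · have h1 : label (K ∪ (F \ G)) = label K ⊔ label (F \ G) := Finset.sup_union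
        have h2 : label (G ∪ (F \ G)) = label G ⊔ label (F \ G) := Finset.sup_union
        rw [h1, hlK, ← h2, Finset.union_sdiff_of_subset hGF']
    have hHF := key H hH hlab.symm
    have hGH : G ⊆ H := by
      intro a ha
      have h1 : a ∈ H ∪ (F \ G) := by rw [hHF]; exact hGF' ha
      rcases Finset.mem_union.1 h1 with h | h
      · exact h
      · exact absurd ha (Finset.mem_sdiff.1 h).2
    refine Finset.Subset.antisymm hGH fun h hh => ?_
    by_contra hhG
    have hhF : h ∈ F := by rw [← hHF]; exact Finset.mem_union_left _ hh
    have hle : h ≤ label (F.erase h) := by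
      have h1 : h ≤ label H := Finset.le_sup (f := id) hh
      rw [← hlab] at h1
      exact h1.trans (label_mono fun a ha =>
        Finset.mem_erase.2 ⟨fun e => hhG (e ▸ ha), hGF' ha⟩)
    have heq : label F = label (F.erase h) := by
      have h1 : label (insert h (F.erase h)) = h ⊔ label (F.erase h) := Finset.sup_insert
      rw [Finset.insert_erase hhF] at h1
      rw [h1, sup_eq_right.2 hle]
    have h2 := hF.2 _ (fun a ha => hF.1 a (Finset.mem_of_mem_erase ha)) heq
    exact Finset.notMem_erase h F (by rw [← h2]; exact hhF)

/-- The faces of dimension `i` (that is, with `i + 1` vertices) of `Δ`. -/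
abbrev FaceOfDim {σ : Type*} (Δ : LowerSet (Finset (σ →₀ ℕ))) (i : ℕ) : Type _ :=
  {F : Finset (σ →₀ ℕ) // F ∈ Δ ∧ F.card = i + 1}

/-- The facet of `F` opposite to its vertex `v`. -/
def FaceOfDim.opposite {σ : Type*} [DecidableEq σ] {Δ : LowerSet (Finset (σ →₀ ℕ))} {i : ℕ}
    (F : FaceOfDim Δ (i + 1)) (v : {v // v ∈ F.1}) : FaceOfDim Δ i :=
  ⟨F.1.erase v.1, Δ.lower (Finset.erase_subset v.1 F.1) F.2.1, by
    rw [Finset.card_erase_of_mem v.2, F.2.2]; rfl⟩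

/-- The position of `v` in `F` (counted from `0`), the vertices being listed in increasing
lexicographic order of their exponent vectors. -/
def position {σ : Type*} [LinearOrder σ] (F : Finset (σ →₀ ℕ)) (v : σ →₀ ℕ) : ℕ :=
  (F.filter fun w => toLex w < toLex v).card

/-- The differential of the complex `F_Δ`, whose `i`-th module is the free module on the
`i`-dimensional faces of `Δ`: the simplicial differential homogenized with respect to the labels,
`e_F ↦ ∑_{v ∈ F} (-1)^{position of v} (m_F / m_{F ∖ v}) e_{F ∖ v}`. -/
noncomputable def cellularD {σ : Type*} [LinearOrder σ] (k : Type*) [Field k]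
    (Δ : LowerSet (Finset (σ →₀ ℕ))) (i : ℕ) :
    (FaceOfDim Δ (i + 1) →₀ MvPolynomial σ k) →ₗ[MvPolynomial σ k]
      (FaceOfDim Δ i →₀ MvPolynomial σ k) :=
  Finsupp.linearCombination (MvPolynomial σ k) fun F : FaceOfDim Δ (i + 1) =>
    ∑ v ∈ F.1.attach, Finsupp.single (F.opposite v)
      (monomial (label F.1 - label (F.opposite v).1) ((-1 : k) ^ position F.1 v.1))

/-- The augmentation of `F_Δ`: the basis element of a vertex `a` is sent to the monomial `x^a`. -/
noncomputable def cellularAug {σ : Type*} (k : Type*) [Field k]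
    (Δ : LowerSet (Finset (σ →₀ ℕ))) :
    (FaceOfDim Δ 0 →₀ MvPolynomial σ k) →ₗ[MvPolynomial σ k] MvPolynomial σ k :=
  Finsupp.linearCombination (MvPolynomial σ k) fun F : FaceOfDim Δ 0 => monomial (label F.1) (1 : k)

/-- A sequence `⋯ → F_1 → F_0 → S` of multigraded free modules over `S = k[x_i : i ∈ σ]`,
where `F_i` is free with a basis `ι i` whose element `x` has multidegree `deg i x`,
is a multigraded free resolution of the ideal `I`: the modules `F_i` have finite rank, the maps are
homogeneous of degree `0`, the image of `F_0 → S` is `I`, and `⋯ → F_1 → F_0 → I → 0` is exact. -/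
structure IsGradedFreeResolution {σ k : Type*} [Field k] {ι : ℕ → Type*}
    (deg : ∀ i, ι i → (σ →₀ ℕ))
    (d : ∀ i, (ι (i + 1) →₀ MvPolynomial σ k) →ₗ[MvPolynomial σ k] (ι i →₀ MvPolynomial σ k))
    (ε : (ι 0 →₀ MvPolynomial σ k) →ₗ[MvPolynomial σ k] MvPolynomial σ k)
    (I : Ideal (MvPolynomial σ k)) : Prop where
  finite_rank : ∀ i, Finite (ι i)
  homogeneous_d : ∀ i x y, ∀ b ∈ (d i (Finsupp.single x 1) y).support, b + deg i y = deg (i + 1) x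
  homogeneous_aug : ∀ x, ∀ b ∈ (ε (Finsupp.single x 1)).support, b = deg 0 x
  range_aug : LinearMap.range ε = I
  exact_zero : Function.Exact (d 0) ε
  exact_succ : ∀ i, Function.Exact (d (i + 1)) (d i)

/-- A multigraded free resolution is minimal if each differential maps into `𝔪 F_i`, where `𝔪` is
the ideal generated by all the variables. -/
structure IsMinimalGradedFreeResolution {σ k : Type*} [Field k] {ι : ℕ → Type*}
    (deg : ∀ i, ι i → (σ →₀ ℕ))
    (d : ∀ i, (ι (i + 1) →₀ MvPolynomial σ k) →ₗ[MvPolynomial σ k] (ι i →₀ MvPolynomial σ k))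
    (ε : (ι 0 →₀ MvPolynomial σ k) →ₗ[MvPolynomial σ k] MvPolynomial σ k)
    (I : Ideal (MvPolynomial σ k)) : Prop extends IsGradedFreeResolution deg d ε I where
  minimal : ∀ i, LinearMap.range (d i) ≤
    Ideal.span (Set.range (X : σ → MvPolynomial σ k)) •
      (⊤ : Submodule (MvPolynomial σ k) (ι i →₀ MvPolynomial σ k))

/-- The complex `F_Δ` is a minimal free resolution of `I`. -/
def SupportsMinimalFreeResolution {σ k : Type*} [LinearOrder σ] [Field k]
    (Δ : LowerSet (Finset (σ →₀ ℕ))) (I : Ideal (MvPolynomial σ k)) : Prop :=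
  IsMinimalGradedFreeResolution (ι := FaceOfDim Δ) (fun _ F => label F.1)
    (cellularD k Δ) (cellularAug k Δ) I

/-- `Ī = I + 𝔪^{u+1} M` in `k[x_1, …, x_m]`, that is, the extension of `I ⊆ k[x_1, …, x_n]` plus
the ideal generated by the monomials `x_i^{u_i+1} M` for `1 ≤ i ≤ n`. -/
noncomputable def idealBar {k : Type*} [Field k] {n m : ℕ} (hnm : n ≤ m) (u : Fin n →₀ ℕ)
    (I : Ideal (MvPolynomial (Fin n) k)) (M : Fin m →₀ ℕ) : Ideal (MvPolynomial (Fin m) k) :=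
  I.map (rename (R := k) (Fin.castLE hnm)) ⊔
    Ideal.span (Set.range fun i : Fin n =>
      monomial (Finsupp.single (Fin.castLE hnm i) (u i + 1) + M) (1 : k))

end MonomialRes

/-!
For every proper monomial ideal `J` the Buchberger complex supports a free resolution; genericity
is used only for its minimality and for the comparison with the Scarf complex.

*Resolution.* The component of multidegree `b` of the complex `F_Δ` is the augmented simplicial
chain complex of the faces of `Δ` with label dividing `b`. So it suffices to prove that these
chain complexes are acyclic for `Δ = Bu(J)` whenever some generator divides `b`
(`exact_cellularD_succ`, `exact_cellularAug`). All sets of generators dividing `b` form a full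
simplex, in which every cycle `z` bounds a cone `w`. If `m_F = m` is properly divided by a generator
`v`, then adding `v` to `F` or removing it from `F` does not change the label, since `v` attains no
positive exponent of `m`. Hence coning with an apex depending only on the label is a homotopy `h`
for which `1 - ∂h - h∂` fixes the faces of `Bu(J)` and strictly lowers the labels of all other
faces (`lowering_mem`). Iterating this chain map moves `w` into `Bu(J)` without changing its
boundary `z` (`exists_boundary_eq`).

*Minimality.* If a vertex `v` of a face `F` of a Buchberger complex is redundant for `m_F`, then `v`
agrees in some positive exponent with another vertex, because it does not properly divide `m_F`
(`exists_apply_eq_of_label_erase_eq`). For `Ī` this cannot happen: two generators coming from `I`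
have an lcm properly divided by a third one, as `I` is generic, and `x_i^{u_i+1} M` is the only
generator whose degree in `x_i` exceeds `u_i` (`label_erase_ne_label`). Thus all coefficients of
the differential are nonunits, and every face of `Bu(Ī)` is determined by its label, that is,
`Bu(Ī) = Sc(Ī)`; the inclusion `Sc ⊆ Bu` holds for every monomial ideal.
-/

namespace MonomialRes

/-! ### Preliminaries on monomials and chains -/

/-- If `v` properly divides `m`, then joining `v` to a proper factor of `m` cannot create the
label `m`. -/
theorem ProperlyDivides.eq_of_sup_eq {σ : Type*} {v a m : σ →₀ ℕ} (hv : ProperlyDivides v m)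
    (ha : a ≤ m) (h : v ⊔ a = m) : a = m := by
  ext i
  have h1 := ha i
  have h2 := DFunLike.congr_fun h i
  rw [Finsupp.sup_apply] at h2
  by_cases hm : m i = 0
  · omega
  · have := (hv.2 i).1 hm
    omega

theorem degree_lt_degree {σ : Type*} {a b : σ →₀ ℕ} (h : a < b) : a.degree < b.degree := by
  have h1 : b = a + (b - a) := (add_tsub_cancel_of_le h.le).symm
  have h2 : b - a ≠ 0 := fun e => h.not_ge (tsub_eq_zero_iff_le.1 e)
  have h3 : (b - a).degree ≠ 0 := fun e => h2 ((Finsupp.degree_eq_zero_iff _).1 e)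
  rw [h1, map_add]
  omega

theorem map_mem_of_mem_supported {R α N : Type*} [Semiring R] [AddCommMonoid N] [Module R N]
    {s : Set α} {P : Submodule R N} (f : (α →₀ R) →ₗ[R] N)
    (h : ∀ a ∈ s, f (Finsupp.single a 1) ∈ P) {c : α →₀ R} (hc : c ∈ Finsupp.supported R R s) :
    f c ∈ P := by
  have : Finsupp.supported R R s ≤ P.comap f := by
    rw [Finsupp.supported_eq_span_single, Submodule.span_le]
    rintro _ ⟨a, ha, rfl⟩
    exact h a ha
  exact this hc

theorem neg_one_pow_mul_self (k : Type*) [Field k] (n : ℕ) : (-1 : k) ^ n * (-1) ^ n = 1 := by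
  rw [← mul_pow]; simp

/-! ### Simplicial chains on finite sets of monomials -/

section Chains

variable {σ : Type*} [LinearOrder σ] (k : Type*) [Field k]

/-- The augmented simplicial boundary on chains of arbitrary finite sets of monomials; the empty
set is a face of dimension `-1`, so that the augmentation is part of the boundary map. -/
noncomputable def boundary : (Finset (σ →₀ ℕ) →₀ k) →ₗ[k] (Finset (σ →₀ ℕ) →₀ k) :=
  Finsupp.linearCombination k fun F =>
    ∑ v ∈ F, Finsupp.single (F.erase v) ((-1 : k) ^ position F v)

/-- The cone operator with apex `v`: it joins `v` to the faces not containing `v` and kills the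
others. The sign makes it a contracting homotopy of the full simplex. -/
noncomputable def cone (v : σ →₀ ℕ) : (Finset (σ →₀ ℕ) →₀ k) →ₗ[k] (Finset (σ →₀ ℕ) →₀ k) :=
  Finsupp.linearCombination k fun F =>
    if v ∈ F then 0 else Finsupp.single (insert v F) ((-1 : k) ^ position (insert v F) v)

theorem position_eq_position_erase_add_one {F : Finset (σ →₀ ℕ)} {v w : σ →₀ ℕ} (hv : v ∈ F)
    (h : toLex v < toLex w) : position F w = position (F.erase v) w + 1 := by
  unfold position
  rw [← Finset.card_erase_add_one (Finset.mem_filter.2 ⟨hv, h⟩), Finset.filter_erase]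

theorem position_erase_of_lt {F : Finset (σ →₀ ℕ)} {v w : σ →₀ ℕ}
    (h : toLex w < toLex v) : position (F.erase v) w = position F w := by
  unfold position
  rw [Finset.filter_erase, Finset.erase_eq_of_notMem]
  exact fun hv => lt_asymm h (Finset.mem_filter.1 hv).2

/-- Removing two vertices in the two possible orders yields opposite signs. -/
theorem sign_erase_erase {F : Finset (σ →₀ ℕ)} {v w : σ →₀ ℕ} (hv : v ∈ F) (hw : w ∈ F)
    (hvw : v ≠ w) :
    (-1 : k) ^ position F v * (-1) ^ position (F.erase v) w =
      -((-1) ^ position F w * (-1) ^ position (F.erase w) v) := by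
  rcases lt_trichotomy (toLex v) (toLex w) with h | h | h
  · rw [position_eq_position_erase_add_one hv h, position_erase_of_lt h, pow_succ]
    ring
  · exact absurd (toLex.injective h) hvw
  · rw [position_eq_position_erase_add_one hw h, position_erase_of_lt h, pow_succ]
    ring

@[simp]
theorem boundary_single (F : Finset (σ →₀ ℕ)) (c : k) :
    boundary k (Finsupp.single F c) =
      ∑ v ∈ F, Finsupp.single (F.erase v) (c * (-1 : k) ^ position F v) := by
  simp [boundary, Finset.smul_sum]

theorem cone_single_of_mem {v : σ →₀ ℕ} {F : Finset (σ →₀ ℕ)} (h : v ∈ F) (c : k) :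
    cone k v (Finsupp.single F c) = 0 := by
  simp [cone, h]

theorem cone_single_of_notMem {v : σ →₀ ℕ} {F : Finset (σ →₀ ℕ)} (h : v ∉ F) (c : k) :
    cone k v (Finsupp.single F c) =
      Finsupp.single (insert v F) (c * (-1 : k) ^ position (insert v F) v) := by
  simp [cone, h]

theorem boundary_boundary (c : Finset (σ →₀ ℕ) →₀ k) : boundary k (boundary k c) = 0 := by
  induction c using Finsupp.induction_linear with
  | zero => simp
  | add f g hf hg => simp [hf, hg]
  | single F c =>
    simp only [boundary_single, map_sum]
    rw [Finset.sum_sigma']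
    refine Finset.sum_involution (fun p _ => ⟨p.2, p.1⟩) ?_ ?_ ?_ ?_
    · rintro ⟨v, w⟩ h
      simp only [Finset.mem_sigma, Finset.mem_erase] at h
      obtain ⟨hv, hwv, hw⟩ := h
      dsimp only
      rw [Finset.erase_right_comm, ← Finsupp.single_add, mul_assoc, mul_assoc,
        sign_erase_erase k hv hw hwv.symm]
      simp
    · rintro ⟨v, w⟩ h - e
      simp only [Finset.mem_sigma, Finset.mem_erase] at h
      exact h.2.1 (congrArg Sigma.fst e)
    · rintro ⟨v, w⟩ h
      simp only [Finset.mem_sigma, Finset.mem_erase] at h ⊢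
      exact ⟨h.2.2, h.2.1.symm, h.1⟩
    · rintro ⟨v, w⟩ h
      rfl

theorem boundary_cone_add_cone_boundary (v : σ →₀ ℕ) (c : Finset (σ →₀ ℕ) →₀ k) :
    boundary k (cone k v c) + cone k v (boundary k c) = c := by
  induction c using Finsupp.induction_linear with
  | zero => simp
  | add f g hf hg =>
    simp only [map_add]
    rw [add_add_add_comm, hf, hg]
  | single F c =>
    by_cases hv : v ∈ F
    · rw [cone_single_of_mem k hv, map_zero, zero_add, boundary_single, map_sum,
        Finset.sum_eq_single_of_mem v hv]
      · rw [cone_single_of_notMem k (Finset.notMem_erase v F), Finset.insert_erase hv, mul_assoc,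
          neg_one_pow_mul_self, mul_one]
      · intro w _ hwv
        exact cone_single_of_mem k (Finset.mem_erase.2 ⟨hwv.symm, hv⟩) _
    · rw [cone_single_of_notMem k hv, boundary_single, boundary_single,
        Finset.sum_insert hv, Finset.erase_insert hv, mul_assoc, neg_one_pow_mul_self, mul_one,
        add_assoc, map_sum, ← Finset.sum_add_distrib, Finset.sum_eq_zero, add_zero]
      intro w hw
      have hvw : v ≠ w := fun e => hv (e ▸ hw)
      rw [cone_single_of_notMem k (fun h => hv (Finset.mem_of_mem_erase h)),
        ← Finset.erase_insert_of_ne hvw, ← Finsupp.single_add, mul_assoc, mul_assoc, ← mul_add]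
      have key := sign_erase_erase k (Finset.mem_insert_self v F)
        (Finset.mem_insert_of_mem hw) hvw
      have h1 : (-1 : k) ^ position (insert v F) v * (-1) ^ position (insert v F) w +
          (-1) ^ position F w * (-1) ^ position ((insert v F).erase w) v = 0 := by
        rw [Finset.erase_insert hv] at key
        have e1 := neg_one_pow_mul_self k (position F w)
        have e2 := neg_one_pow_mul_self k (position (insert v F) w)
        linear_combination ((-1) ^ position F w * (-1) ^ position (insert v F) w) * key
          - ((-1 : k) ^ position (insert v F) v * (-1) ^ position (insert v F) w) * e1
          - ((-1) ^ position F w * (-1) ^ position ((insert v F).erase w) v) * e2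
      rw [h1, mul_zero, Finsupp.single_zero]

/-! ### Retracting the Taylor complex onto the Buchberger complex -/

/-- The cone operator whose apex is a chosen element of `V` that properly divides `m`, and `0` if
there is no such element. -/
noncomputable def strictCone (V : Set (σ →₀ ℕ)) (m : σ →₀ ℕ) :
    (Finset (σ →₀ ℕ) →₀ k) →ₗ[k] (Finset (σ →₀ ℕ) →₀ k) :=
  open Classical in
  if h : ∃ v ∈ V, ProperlyDivides v m then cone k h.choose else 0

/-- The operator that cones each face `F` from a chosen monomial properly dividing `m_F`. On faces
with a fixed label the apex is fixed, and coning does not change the label. -/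
noncomputable def labelCone (V : Set (σ →₀ ℕ)) :
    (Finset (σ →₀ ℕ) →₀ k) →ₗ[k] (Finset (σ →₀ ℕ) →₀ k) :=
  Finsupp.linearCombination k fun F => strictCone k V (label F) (Finsupp.single F 1)

/-- The chain map `1 - ∂h - h∂`, homotopic to the identity, where `h` is `labelCone`. It fixes the
faces of the Buchberger complex and strictly lowers the labels of all other faces. -/
noncomputable def lowering (V : Set (σ →₀ ℕ)) :
    (Finset (σ →₀ ℕ) →₀ k) →ₗ[k] (Finset (σ →₀ ℕ) →₀ k) :=
  LinearMap.id - boundary k ∘ₗ labelCone k V - labelCone k V ∘ₗ boundary k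

theorem lowering_apply (V : Set (σ →₀ ℕ)) (c : Finset (σ →₀ ℕ) →₀ k) :
    lowering k V c = c - boundary k (labelCone k V c) - labelCone k V (boundary k c) := rfl

theorem labelCone_single (V : Set (σ →₀ ℕ)) (F : Finset (σ →₀ ℕ)) (c : k) :
    labelCone k V (Finsupp.single F c) = strictCone k V (label F) (Finsupp.single F c) := by
  rw [labelCone, Finsupp.linearCombination_single, ← map_smul]
  simp

theorem boundary_lowering (V : Set (σ →₀ ℕ)) (c : Finset (σ →₀ ℕ) →₀ k) :
    boundary k (lowering k V c) = lowering k V (boundary k c) := by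
  simp [lowering_apply, boundary_boundary]

theorem label_insert (v : σ →₀ ℕ) (F : Finset (σ →₀ ℕ)) : label (insert v F) = v ⊔ label F :=
  Finset.sup_insert

/-- Chains on those faces of the full simplex on `V` that have `j` vertices, label at most `b`, and
either lie in the Buchberger complex or have label of degree less than `N`. -/
noncomputable def filteredChains (V : Set (σ →₀ ℕ)) (b : σ →₀ ℕ) (j N : ℕ) :
    Submodule k (Finset (σ →₀ ℕ) →₀ k) :=
  Finsupp.supported k k {F | (∀ a ∈ F, a ∈ V) ∧ F.card = j ∧ label F ≤ b ∧
    ((∀ v ∈ V, ¬ ProperlyDivides v (label F)) ∨ (label F).degree < N)}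

variable {k}

theorem strictCone_single_of_not {V : Set (σ →₀ ℕ)} {m : σ →₀ ℕ}
    (h : ∀ v ∈ V, ¬ ProperlyDivides v m) : strictCone k V m = 0 := by
  rw [strictCone, dif_neg]
  rintro ⟨v, hv, hvm⟩
  exact h v hv hvm

theorem lowering_single_of_face {V : Set (σ →₀ ℕ)} {F : Finset (σ →₀ ℕ)}
    (hF : ∀ v ∈ V, ¬ ProperlyDivides v (label F)) (c : k) :
    lowering k V (Finsupp.single F c) = Finsupp.single F c := by
  rw [lowering_apply, labelCone_single, strictCone_single_of_not hF, boundary_single, map_sum,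
    Finset.sum_eq_zero]
  · simp
  · intro v _
    rw [labelCone_single, strictCone_single_of_not]
    · rfl
    · exact fun w hw h => hF w hw (h.trans_le (label_mono (Finset.erase_subset v F)))

theorem lowering_mem {V : Set (σ →₀ ℕ)} {b : σ →₀ ℕ} {j N : ℕ} {c : Finset (σ →₀ ℕ) →₀ k}
    (hc : c ∈ filteredChains k V b j (N + 1)) : lowering k V c ∈ filteredChains k V b j N := by
  refine map_mem_of_mem_supported _ ?_ hc
  rintro F ⟨hFV, hFj, hFb, hF⟩
  by_cases hBu : ∀ v ∈ V, ¬ ProperlyDivides v (label F)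
  · rw [lowering_single_of_face hBu]
    exact Finsupp.single_mem_supported k _ ⟨hFV, hFj, hFb, Or.inl hBu⟩
  have hN := hF.resolve_left hBu
  push Not at hBu
  obtain ⟨v, hv, hvF⟩ := hBu
  have hex : ∃ v ∈ V, ProperlyDivides v (label F) := ⟨v, hv, hvF⟩
  clear hv hvF v
  obtain ⟨hv, hvF⟩ := hex.choose_spec
  have hcone : strictCone k V (label F) = cone k hex.choose := by rw [strictCone, dif_pos hex]
  -- The contributions of the apex belonging to `m_F` itself cancel by the homotopy formula.
  have key : lowering k V (Finsupp.single F (1 : k)) =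
      ∑ w ∈ F, (strictCone k V (label F) (Finsupp.single (F.erase w) (1 * (-1) ^ position F w)) -
        strictCone k V (label (F.erase w))
          (Finsupp.single (F.erase w) (1 * (-1) ^ position F w))) := by
    rw [Finset.sum_sub_distrib, ← map_sum, ← boundary_single, lowering_apply, labelCone_single,
      hcone]
    nth_rewrite 1 [← boundary_cone_add_cone_boundary k hex.choose (Finsupp.single F (1 : k))]
    rw [add_sub_cancel_left, boundary_single k F, map_sum (labelCone k V)]
    simp_rw [labelCone_single]
  rw [key]
  refine Submodule.sum_mem _ fun w hw => ?_
  have hle : label (F.erase w) ≤ label F := label_mono (Finset.erase_subset w F)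
  have hwV : ∀ a ∈ F.erase w, a ∈ V := fun a ha => hFV a (Finset.mem_of_mem_erase ha)
  by_cases heq : label (F.erase w) = label F
  · rw [heq, sub_self]
    exact zero_mem _
  -- A cone over a face of smaller label, with apex properly dividing `m_F`, has smaller label.
  have hmem : ∀ x ∈ V, ProperlyDivides x (label F) → ∀ c : k,
      cone k x (Finsupp.single (F.erase w) c) ∈ filteredChains k V b j N := by
    intro x hx hxF c
    by_cases hxw : x ∈ F.erase w
    · rw [cone_single_of_mem k hxw]
      exact zero_mem _
    rw [cone_single_of_notMem k hxw]
    have hle' : x ⊔ label (F.erase w) ≤ label F := sup_le hxF.1 hle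
    refine Finsupp.single_mem_supported k _ ⟨?_, ?_, ?_, Or.inr ?_⟩
    · intro a ha
      rcases Finset.mem_insert.1 ha with rfl | ha
      · exact hx
      · exact hwV a ha
    · rw [Finset.card_insert_of_notMem hxw, Finset.card_erase_add_one hw, hFj]
    · rw [label_insert]
      exact hle'.trans hFb
    · rw [label_insert]
      have := degree_lt_degree (lt_of_le_of_ne hle' fun e => heq (hxF.eq_of_sup_eq hle e))
      omega
  refine sub_mem ?_ ?_
  · rw [hcone]
    exact hmem _ hv hvF _
  · by_cases hex' : ∃ v ∈ V, ProperlyDivides v (label (F.erase w))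
    · rw [strictCone, dif_pos hex']
      exact hmem _ hex'.choose_spec.1 (hex'.choose_spec.2.trans_le hle) _
    · rw [strictCone, dif_neg hex']
      exact zero_mem _

theorem lowering_iterate_mem {V : Set (σ →₀ ℕ)} {b : σ →₀ ℕ} {j N : ℕ}
    {c : Finset (σ →₀ ℕ) →₀ k} (hc : c ∈ filteredChains k V b j N) :
    (lowering k V)^[N] c ∈ filteredChains k V b j 0 := by
  induction N generalizing c with
  | zero => exact hc
  | succ N ih => exact ih (lowering_mem hc)

theorem lowering_eq_self {V : Set (σ →₀ ℕ)} {b : σ →₀ ℕ} {j : ℕ} {c : Finset (σ →₀ ℕ) →₀ k}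
    (hc : c ∈ filteredChains k V b j 0) : lowering k V c = c := by
  have h : lowering k V c - c ∈ (⊥ : Submodule k (Finset (σ →₀ ℕ) →₀ k)) := by
    refine map_mem_of_mem_supported (lowering k V - LinearMap.id) ?_ hc
    rintro F ⟨-, -, -, hF⟩
    have hF := hF.resolve_right (Nat.not_lt_zero _)
    simp [lowering_single_of_face hF]
  exact sub_eq_zero.1 h

/-- The part of the Buchberger complex below `b` is acyclic: a cycle bounds a cone in the full
simplex, and iterating `lowering` pushes that cone into the Buchberger complex while fixing its
boundary. -/
theorem exists_boundary_eq {V : Set (σ →₀ ℕ)} {b v : σ →₀ ℕ} {j : ℕ} {z : Finset (σ →₀ ℕ) →₀ k}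
    (hv : v ∈ V) (hvb : v ≤ b) (hz : z ∈ filteredChains k V b j 0) (hz0 : boundary k z = 0) :
    ∃ w ∈ filteredChains k V b (j + 1) 0, boundary k w = z := by
  have hcone : cone k v z ∈ filteredChains k V b (j + 1) (b.degree + 1) := by
    refine map_mem_of_mem_supported _ ?_ hz
    rintro F ⟨hFV, hFj, hFb, hF⟩
    by_cases hvF : v ∈ F
    · rw [cone_single_of_mem k hvF]
      exact zero_mem _
    rw [cone_single_of_notMem k hvF]
    have hle : label (insert v F) ≤ b := by
      rw [label_insert]
      exact sup_le hvb hFb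
    refine Finsupp.single_mem_supported k _ ⟨?_, ?_, hle, Or.inr ?_⟩
    · intro a ha
      rcases Finset.mem_insert.1 ha with rfl | ha
      · exact hv
      · exact hFV a ha
    · rw [Finset.card_insert_of_notMem hvF, hFj]
    · rcases hle.eq_or_lt with e | h
      · rw [e]
        omega
      · have := degree_lt_degree h
        omega
  refine ⟨_, lowering_iterate_mem hcone, ?_⟩
  have hcomm : Function.Semiconj (boundary k) (lowering k V) (lowering k V) :=
    boundary_lowering k V
  have hbd : boundary k (cone k v z) = z := by
    simpa [hz0] using boundary_cone_add_cone_boundary k v z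
  rw [hcomm.iterate_right _ _, hbd]
  exact Function.iterate_fixed (lowering_eq_self hz) _

end Chains

/-! ### Multigraded strands of `F_Δ` -/

section Strands

variable {σ : Type*} {k : Type*} [Field k] {Δ : LowerSet (Finset (σ →₀ ℕ))}

/-- Chains on the faces of `Δ` that have `j` vertices and label at most `b`. -/
noncomputable def strandChains (k : Type*) [Field k] (Δ : LowerSet (Finset (σ →₀ ℕ)))
    (b : σ →₀ ℕ) (j : ℕ) : Submodule k (Finset (σ →₀ ℕ) →₀ k) :=
  Finsupp.supported k k {F | F ∈ Δ ∧ F.card = j ∧ label F ≤ b}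

/-- The decomposition of an element of `F_Δ` into its homogeneous components: the component of
multidegree `b` is recorded as the chain in which a face `F` carries the coefficient of
`x^(b - m_F) e_F`. -/
noncomputable def strand (k : Type*) [Field k] (Δ : LowerSet (Finset (σ →₀ ℕ))) (i : ℕ) :
    (FaceOfDim Δ i →₀ MvPolynomial σ k) →ₗ[k] ((σ →₀ ℕ) →₀ (Finset (σ →₀ ℕ) →₀ k)) :=
  Finsupp.lsum k fun F => (basisMonomials σ k).constr k fun a =>
    Finsupp.single (a + label F.1) (Finsupp.single F.1 (1 : k))

open Classical in
/-- The homogeneous element of multidegree `b` of `F_Δ` with given chain of coefficients. -/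
noncomputable def homogenize (k : Type*) [Field k] (Δ : LowerSet (Finset (σ →₀ ℕ))) (i : ℕ)
    (b : σ →₀ ℕ) : (Finset (σ →₀ ℕ) →₀ k) →ₗ[k] (FaceOfDim Δ i →₀ MvPolynomial σ k) :=
  Finsupp.linearCombination k fun F =>
    if h : F ∈ Δ ∧ F.card = i + 1 then
      Finsupp.single ⟨F, h⟩ (monomial (b - label F) (1 : k)) else 0

theorem strand_single {i : ℕ} (F : FaceOfDim Δ i) (a : σ →₀ ℕ) (c : k) :
    strand k Δ i (Finsupp.single F (monomial a c)) =
      Finsupp.single (a + label F.1) (Finsupp.single F.1 c) := by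
  have h : (monomial a c : MvPolynomial σ k) = c • basisMonomials σ k a := by
    simp [smul_monomial]
  rw [strand, Finsupp.lsum_single, h, map_smul, Module.Basis.constr_basis]
  simp

theorem homogenize_single {i : ℕ} (F : FaceOfDim Δ i) (b : σ →₀ ℕ) (c : k) :
    homogenize k Δ i b (Finsupp.single F.1 c) =
      Finsupp.single F (monomial (b - label F.1) c) := by
  rw [homogenize, Finsupp.linearCombination_single, dif_pos F.2]
  simp [smul_monomial]

/-- Induction over the monomial basis of a free module over a polynomial ring. -/
theorem induction_single_monomial {ι : Type*} {p : (ι →₀ MvPolynomial σ k) → Prop}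
    (z : ι →₀ MvPolynomial σ k) (zero : p 0) (add : ∀ x y, p x → p y → p (x + y))
    (single : ∀ F a c, p (Finsupp.single F (monomial a c))) : p z := by
  induction z using Finsupp.induction_linear with
  | zero => exact zero
  | add f g hf hg => exact add f g hf hg
  | single F q =>
    induction q using MvPolynomial.induction_on' with
    | monomial a c => exact single F a c
    | add p q hp hq =>
      rw [Finsupp.single_add]
      exact add _ _ hp hq

theorem sum_homogenize_strand {i : ℕ} (z : FaceOfDim Δ i →₀ MvPolynomial σ k) :
    ((strand k Δ i z).sum fun b c => homogenize k Δ i b c) = z := by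
  change Finsupp.lsum k (fun b => homogenize k Δ i b) (strand k Δ i z) = z
  induction z using induction_single_monomial with
  | zero => simp
  | add x y hx hy => rw [map_add, map_add, hx, hy]
  | single F a c =>
    rw [strand_single, Finsupp.lsum_single, homogenize_single, add_tsub_cancel_right]

theorem strand_injective (i : ℕ) : Function.Injective (strand k Δ i) := fun x y h => by
  rw [← sum_homogenize_strand x, h, sum_homogenize_strand]

theorem strand_apply_mem {i : ℕ} (z : FaceOfDim Δ i →₀ MvPolynomial σ k) (b : σ →₀ ℕ) :
    strand k Δ i z b ∈ strandChains k Δ b (i + 1) := by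
  induction z using induction_single_monomial with
  | zero => simp
  | add x y hx hy =>
    rw [map_add, Finsupp.add_apply]
    exact add_mem hx hy
  | single F a c =>
    classical
    rw [strand_single, Finsupp.single_apply]
    split_ifs with h
    · exact Finsupp.single_mem_supported k _ ⟨F.2.1, F.2.2, h ▸ le_add_self⟩
    · exact zero_mem _

theorem homogeneous_cellularAug (F : FaceOfDim Δ 0) {b : σ →₀ ℕ}
    (hb : b ∈ (cellularAug k Δ (Finsupp.single F 1)).support) : b = label F.1 := by
  rw [cellularAug, Finsupp.linearCombination_single, one_smul] at hb
  exact Finset.mem_singleton.1 (support_monomial_subset hb)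

theorem monomial_mem_span_X {a : σ →₀ ℕ} (ha : a ≠ 0) (c : k) :
    (monomial a c : MvPolynomial σ k) ∈
      Ideal.span (Set.range (X : σ → MvPolynomial σ k)) := by
  obtain ⟨i, hi⟩ := Finsupp.ne_iff.1 ha
  have h : (monomial a c : MvPolynomial σ k) = monomial (a - Finsupp.single i 1) c * X i := by
    rw [X, monomial_mul, mul_one, tsub_add_cancel_of_le]
    exact Finsupp.single_le_iff.2 (Nat.one_le_iff_ne_zero.2 hi)
  rw [h]
  exact Ideal.mul_mem_left _ _ (Ideal.subset_span ⟨i, rfl⟩)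

variable [LinearOrder σ]

theorem cellularD_single {i : ℕ} (F : FaceOfDim Δ (i + 1)) (p : MvPolynomial σ k) :
    cellularD k Δ i (Finsupp.single F p) = ∑ v ∈ F.1.attach, Finsupp.single (F.opposite v)
      (p * monomial (label F.1 - label (F.opposite v).1) ((-1 : k) ^ position F.1 v.1)) := by
  simp [cellularD, Finset.smul_sum]

theorem label_opposite_le {i : ℕ} (F : FaceOfDim Δ (i + 1)) (v : {v // v ∈ F.1}) :
    label (F.opposite v).1 ≤ label F.1 :=
  label_mono (Finset.erase_subset _ _)

theorem strand_cellularD {i : ℕ} (z : FaceOfDim Δ (i + 1) →₀ MvPolynomial σ k) :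
    strand k Δ i (cellularD k Δ i z) =
      Finsupp.mapRange.linearMap (boundary k) (strand k Δ (i + 1) z) := by
  induction z using induction_single_monomial with
  | zero => simp
  | add x y hx hy => rw [map_add, map_add, map_add, map_add, hx, hy]
  | single F a c =>
    rw [cellularD_single, map_sum, strand_single, Finsupp.mapRange.linearMap_apply,
      Finsupp.mapRange_single, boundary_single, ← Finset.sum_attach F.1, Finsupp.single_finsetSum]
    refine Finset.sum_congr rfl fun v _ => ?_
    rw [monomial_mul, strand_single, add_assoc, tsub_add_cancel_of_le (label_opposite_le F v)]
    rfl

theorem boundary_strand_zero (z : FaceOfDim Δ 0 →₀ MvPolynomial σ k) (b : σ →₀ ℕ) :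
    boundary k (strand k Δ 0 z b) = Finsupp.single ∅ (coeff b (cellularAug k Δ z)) := by
  induction z using induction_single_monomial with
  | zero => simp
  | add x y hx hy =>
    rw [map_add, map_add, Finsupp.add_apply, map_add, hx, hy, coeff_add, Finsupp.single_add]
  | single F a c =>
    obtain ⟨F, hF, hcard⟩ := F
    obtain ⟨v, rfl⟩ := Finset.card_eq_one.1 hcard
    have hpos : position {v} v = 0 := by simp [position]
    rw [strand_single, cellularAug, Finsupp.linearCombination_single, smul_eq_mul, monomial_mul,
      coeff_monomial, mul_one, Finsupp.single_apply]
    split_ifs with h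
    · rw [boundary_single, Finset.sum_singleton, hpos, pow_zero, mul_one,
        Finset.erase_singleton]
    · simp

theorem cellularD_homogenize {i : ℕ} {b : σ →₀ ℕ} {w : Finset (σ →₀ ℕ) →₀ k}
    (hw : w ∈ strandChains k Δ b (i + 2)) :
    cellularD k Δ i (homogenize k Δ (i + 1) b w) = homogenize k Δ i b (boundary k w) := by
  have h : ((cellularD k Δ i).restrictScalars k ∘ₗ homogenize k Δ (i + 1) b -
      homogenize k Δ i b ∘ₗ boundary k) w ∈
      (⊥ : Submodule k (FaceOfDim Δ i →₀ MvPolynomial σ k)) := by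
    refine map_mem_of_mem_supported _ ?_ hw
    rintro F ⟨hF, hcard, hb⟩
    obtain ⟨F, rfl⟩ : ∃ G : FaceOfDim Δ (i + 1), F = G.1 := ⟨⟨F, hF, hcard⟩, rfl⟩
    rw [Submodule.mem_bot, LinearMap.sub_apply, sub_eq_zero]
    simp only [LinearMap.comp_apply, LinearMap.restrictScalars_apply]
    rw [homogenize_single F, cellularD_single, boundary_single, map_sum,
      ← Finset.sum_attach F.1]
    refine Finset.sum_congr rfl fun v _ => ?_
    rw [monomial_mul, tsub_add_tsub_cancel hb (label_opposite_le F v)]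
    exact (homogenize_single (F.opposite v) b _).symm
  exact sub_eq_zero.1 h

/-- An element all of whose homogeneous components bound is in the image of the differential. -/
theorem mem_range_cellularD {i : ℕ} {z : FaceOfDim Δ i →₀ MvPolynomial σ k}
    (h : ∀ b, ∃ w ∈ strandChains k Δ b (i + 2), boundary k w = strand k Δ i z b) :
    z ∈ LinearMap.range (cellularD k Δ i) := by
  rw [← sum_homogenize_strand z]
  refine Submodule.sum_mem _ fun b _ => ?_
  obtain ⟨w, hw, hwz⟩ := h b
  refine ⟨homogenize k Δ (i + 1) b w, ?_⟩
  rw [cellularD_homogenize hw, hwz]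

/-- If all strands of `Δ` are acyclic, then `F_Δ` is exact in positive homological degrees. -/
theorem exact_cellularD_succ
    (hΔ : ∀ b j, ∀ z ∈ strandChains k Δ b (j + 1), boundary k z = 0 →
      ∃ w ∈ strandChains k Δ b (j + 2), boundary k w = z) (i : ℕ) :
    Function.Exact (cellularD k Δ (i + 1)) (cellularD k Δ i) := by
  intro z
  constructor
  · intro hz
    refine mem_range_cellularD fun b => hΔ b _ _ (strand_apply_mem z b) ?_
    have h := strand_cellularD z
    rw [hz, map_zero] at h
    exact (DFunLike.congr_fun h b).symm
  · rintro ⟨w, rfl⟩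
    apply strand_injective
    rw [strand_cellularD, strand_cellularD, map_zero]
    ext1 b
    simp [boundary_boundary]

/-- If all strands of `Δ` are acyclic, then `F_Δ` is exact in homological degree `0`. -/
theorem exact_cellularAug
    (hΔ : ∀ b j, ∀ z ∈ strandChains k Δ b (j + 1), boundary k z = 0 →
      ∃ w ∈ strandChains k Δ b (j + 2), boundary k w = z) :
    Function.Exact (cellularD k Δ 0) (cellularAug k Δ) := by
  intro z
  constructor
  · intro hz
    refine mem_range_cellularD fun b => hΔ b _ _ (strand_apply_mem z b) ?_
    rw [boundary_strand_zero, hz]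
    simp
  · rintro ⟨w, rfl⟩
    ext b
    have h := boundary_strand_zero (cellularD k Δ 0 w) b
    rw [strand_cellularD, Finsupp.mapRange.linearMap_apply, Finsupp.mapRange_apply,
      boundary_boundary] at h
    simpa using h.symm

theorem homogeneous_cellularD {i : ℕ} (F : FaceOfDim Δ (i + 1)) (G : FaceOfDim Δ i)
    {b : σ →₀ ℕ} (hb : b ∈ (cellularD k Δ i (Finsupp.single F 1) G).support) :
    b + label G.1 = label F.1 := by
  rw [cellularD_single, Finsupp.finsetSum_apply, mem_support_iff, coeff_sum] at hb
  obtain ⟨v, -, hv⟩ := Finset.exists_ne_zero_of_sum_ne_zero hb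
  rw [Finsupp.single_apply] at hv
  split_ifs at hv with h
  · rw [one_mul, coeff_monomial] at hv
    split_ifs at hv with h'
    · rw [← h', ← h, tsub_add_cancel_of_le (label_opposite_le F v)]
    · exact absurd rfl hv
  · simp at hv

/-- The differential is minimal as soon as removing a vertex from a face changes its label. -/
theorem range_cellularD_le (hΔ : ∀ F ∈ Δ, ∀ v ∈ F, label (F.erase v) ≠ label F) (i : ℕ) :
    LinearMap.range (cellularD k Δ i) ≤ Ideal.span (Set.range (X : σ → MvPolynomial σ k)) •
      (⊤ : Submodule (MvPolynomial σ k) (FaceOfDim Δ i →₀ MvPolynomial σ k)) := by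
  rw [cellularD, Finsupp.range_linearCombination, Submodule.span_le]
  rintro _ ⟨F, rfl⟩
  refine Submodule.sum_mem _ fun v _ => ?_
  rw [← mul_one (monomial _ _), ← smul_eq_mul, ← Finsupp.smul_single]
  refine Submodule.smul_mem_smul (monomial_mem_span_X ?_ _) trivial
  intro h
  exact hΔ F.1 F.2.1 v.1 v.2 (le_antisymm (label_opposite_le F v) (tsub_eq_zero_iff_le.1 h))

end Strands

/-! ### The Buchberger resolution of a monomial ideal -/

section Buchberger

variable {σ k : Type*} [Field k]

theorem finite_minGen [Finite σ] (J : Ideal (MvPolynomial σ k)) : (minGen J).Finite :=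
  WellQuasiOrderedLE.finite_of_isAntichain (setOfPred_minimal_antichain _)

theorem monomial_mem_of_le {J : Ideal (MvPolynomial σ k)} {a b : σ →₀ ℕ} (hab : a ≤ b)
    (ha : monomial a (1 : k) ∈ J) : monomial b (1 : k) ∈ J := by
  have h : (monomial b (1 : k) : MvPolynomial σ k) = monomial (b - a) 1 * monomial a 1 := by
    rw [monomial_mul, mul_one, tsub_add_cancel_of_le hab]
  rw [h]
  exact J.mul_mem_left _ ha

theorem exists_minGen_le [Finite σ] {J : Ideal (MvPolynomial σ k)} {a : σ →₀ ℕ}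
    (ha : monomial a (1 : k) ∈ J) : ∃ b ∈ minGen J, b ≤ a := by
  obtain ⟨b, hb, hmin⟩ :=
    exists_minimal_le_of_wellFoundedLT (fun b : σ →₀ ℕ => monomial b (1 : k) ∈ J) a ha
  exact ⟨b, hmin, hb⟩

theorem zero_notMem_minGen {J : Ideal (MvPolynomial σ k)} (hJ : J ≠ ⊤) :
    (0 : σ →₀ ℕ) ∉ minGen J := fun h => hJ ((Ideal.eq_top_iff_one J).2 h.1)

theorem singleton_mem_buchbergerComplex {J : Ideal (MvPolynomial σ k)} (hJ : J ≠ ⊤)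
    {a : σ →₀ ℕ} (ha : a ∈ minGen J) : {a} ∈ buchbergerComplex J := by
  refine ⟨fun b hb => Finset.mem_singleton.1 hb ▸ ha, fun u hu h => ?_⟩
  rw [label, Finset.sup_singleton, id] at h
  have hua : u = a := le_antisymm h.1 (ha.2 hu.1 h.1)
  subst hua
  refine zero_notMem_minGen hJ ?_
  convert ha
  ext i
  by_contra hi
  exact lt_irrefl _ ((h.2 i).1 (Ne.symm hi))

theorem strandChains_buchbergerComplex (J : Ideal (MvPolynomial σ k)) (b : σ →₀ ℕ) (j : ℕ) :
    strandChains k (buchbergerComplex J) b j = filteredChains k (minGen J) b j 0 := by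
  refine congrArg _ (Set.ext fun F => ?_)
  constructor
  · rintro ⟨⟨h1, h2⟩, h3, h4⟩
    exact ⟨h1, h3, h4, Or.inl h2⟩
  · rintro ⟨h1, h3, h4, h2⟩
    exact ⟨⟨h1, h2.resolve_right (Nat.not_lt_zero _)⟩, h3, h4⟩

theorem range_cellularAug_buchbergerComplex [Finite σ] {A : Set (σ →₀ ℕ)}
    {J : Ideal (MvPolynomial σ k)} (hJ : J ≠ ⊤)
    (hA : J = Ideal.span ((fun a => monomial a (1 : k)) '' A)) :
    LinearMap.range (cellularAug k (buchbergerComplex J)) = J := by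
  rw [cellularAug, Finsupp.range_linearCombination]
  apply le_antisymm
  · rw [Submodule.span_le]
    rintro _ ⟨⟨F, hF, hcard⟩, rfl⟩
    obtain ⟨a, rfl⟩ := Finset.card_eq_one.1 hcard
    have ha := hF.1 a (Finset.mem_singleton_self a)
    simpa [label] using ha.1
  · conv_lhs => rw [hA]
    refine Ideal.span_le.2 ?_
    rintro _ ⟨a, ha, rfl⟩
    have haJ : monomial a (1 : k) ∈ J := by
      rw [hA]
      exact Ideal.subset_span ⟨a, ha, rfl⟩
    obtain ⟨b, hb, hba⟩ := exists_minGen_le haJ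
    refine monomial_mem_of_le hba (Ideal.subset_span
      ⟨⟨{b}, singleton_mem_buchbergerComplex hJ hb, Finset.card_singleton b⟩, ?_⟩)
    simp [label]

/-- The Buchberger complex of a proper monomial ideal supports a free resolution. -/
theorem isGradedFreeResolution_buchbergerComplex [LinearOrder σ] [Finite σ] {A : Set (σ →₀ ℕ)}
    {J : Ideal (MvPolynomial σ k)} (hJ : J ≠ ⊤)
    (hA : J = Ideal.span ((fun a => monomial a (1 : k)) '' A)) :
    IsGradedFreeResolution (ι := FaceOfDim (buchbergerComplex J)) (fun _ F => label F.1)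
      (cellularD k (buchbergerComplex J)) (cellularAug k (buchbergerComplex J)) J := by
  have hacyclic : ∀ b j, ∀ z ∈ strandChains k (buchbergerComplex J) b (j + 1),
      boundary k z = 0 →
      ∃ w ∈ strandChains k (buchbergerComplex J) b (j + 2), boundary k w = z := by
    intro b j z hz hz0
    by_cases h0 : z = 0
    · exact ⟨0, zero_mem _, by rw [h0, map_zero]⟩
    obtain ⟨F, hF⟩ := Finsupp.support_nonempty_iff.2 h0
    obtain ⟨hFΔ, hcard, hFb⟩ := (Finsupp.mem_supported k z).1 hz hF
    obtain ⟨v, hv⟩ : F.Nonempty := Finset.card_pos.1 (by omega)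
    rw [strandChains_buchbergerComplex] at hz ⊢
    exact exists_boundary_eq (hFΔ.1 v hv) ((Finset.le_sup (f := id) hv).trans hFb) hz hz0
  refine ⟨fun i => ?_, fun i F G b hb => homogeneous_cellularD F G hb,
    fun F b hb => homogeneous_cellularAug F hb, range_cellularAug_buchbergerComplex hJ hA,
    exact_cellularAug hacyclic, exact_cellularD_succ hacyclic⟩
  refine ((finite_minGen J).toFinset.powerset.finite_toSet.subset fun F hF => ?_).to_subtype
  exact Finset.mem_powerset.2 fun a ha => (finite_minGen J).mem_toFinset.2 (hF.1.1 a ha)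

end Buchberger

section Buchberger

variable {σ k : Type*} [Field k]

/-! ### Comparison of the Buchberger and Scarf complexes -/

theorem scarfComplex_le_buchbergerComplex (J : Ideal (MvPolynomial σ k)) :
    scarfComplex J ≤ buchbergerComplex J := by
  classical
  rintro F ⟨hFJ, hF⟩
  refine ⟨hFJ, fun v hv hvF => ?_⟩
  -- Adjoining or removing a proper divisor of `m_F` does not change the label.
  have hins : F = insert v F := by
    refine hF _ ?_ ?_
    · intro a ha
      rcases Finset.mem_insert.1 ha with rfl | ha
      · exact hv
      · exact hFJ a ha
    · rw [label, label, Finset.sup_insert]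
      exact (sup_eq_right.2 hvF.1).symm
  have hvmem : v ∈ F := by
    rw [hins]
    exact Finset.mem_insert_self v F
  have hers : F = F.erase v := by
    refine hF _ (fun a ha => hFJ a (Finset.mem_of_mem_erase ha)) ?_
    refine (hvF.eq_of_sup_eq (label_mono (Finset.erase_subset v F)) ?_).symm
    conv_rhs => rw [← Finset.insert_erase hvmem]
    exact Finset.sup_insert.symm
  rw [hers] at hvmem
  exact Finset.notMem_erase v F hvmem

/-- If no vertex of a face of the Buchberger complex is redundant for its label, then every face
of the Buchberger complex is determined by its label. -/
theorem buchbergerComplex_le_scarfComplex [DecidableEq σ] {J : Ideal (MvPolynomial σ k)}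
    (h : ∀ F ∈ buchbergerComplex J, ∀ v ∈ F, label (F.erase v) ≠ label F) :
    buchbergerComplex J ≤ scarfComplex J := by
  rintro F ⟨hFJ, hF⟩
  refine ⟨hFJ, fun G hGJ hlab => ?_⟩
  have hunion : label (F ∪ G) = label F := by
    have h1 : label (F ∪ G) = label F ⊔ label G := Finset.sup_union
    rw [h1, ← hlab, sup_idem]
  have hFG : F ∪ G ∈ buchbergerComplex J :=
    ⟨fun a ha => (Finset.mem_union.1 ha).elim (hFJ a) (hGJ a), by rwa [hunion]⟩
  have key : ∀ K ⊆ F ∪ G, label K = label (F ∪ G) → F ∪ G ⊆ K := by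
    intro K hK hlK v hv
    by_contra hvK
    refine h _ hFG v hv (le_antisymm (label_mono (Finset.erase_subset v _)) ?_)
    rw [← hlK]
    exact label_mono (Finset.subset_erase.2 ⟨hK, hvK⟩)
  exact Finset.Subset.antisymm
    (Finset.subset_union_left.trans (key G Finset.subset_union_right (by rw [hunion, hlab])))
    (Finset.subset_union_right.trans (key F Finset.subset_union_left hunion.symm))

/-- A vertex that is redundant for the label of a face `F` of the Buchberger complex agrees with
another vertex in some variable, since it does not properly divide `m_F`. -/
theorem exists_apply_eq_of_label_erase_eq [DecidableEq σ] {J : Ideal (MvPolynomial σ k)}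
    {F : Finset (σ →₀ ℕ)} (hF : F ∈ buchbergerComplex J) {v : σ →₀ ℕ} (hv : v ∈ F)
    (h : label (F.erase v) = label F) : ∃ w ∈ F, w ≠ v ∧ ∃ i, v i = w i ∧ 0 < v i := by
  have hle : v ≤ label F := Finset.le_sup (f := id) hv
  obtain ⟨i, hi, hi0⟩ : ∃ i, v i = label F i ∧ 0 < v i := by
    by_contra! hcon
    refine hF.2 v (hF.1 v hv) ⟨hle, fun i => ⟨fun hi => ?_, fun hi => ?_⟩⟩
    · have h1 := hle i
      have h2 := hcon i
      omega
    · have h1 := hle i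
      omega
  have happ : ∀ G : Finset (σ →₀ ℕ), label G i = G.sup fun w => w i := fun G =>
    Finset.apply_sup_eq_sup_comp (fun a : σ →₀ ℕ => a i) (fun _ _ => rfl) rfl
  obtain ⟨w, hw, hwi⟩ : ∃ w ∈ F.erase v, (F.erase v).sup (fun w => w i) = w i := by
    refine Finset.exists_mem_eq_sup _ ?_ _
    by_contra hemp
    rw [Finset.not_nonempty_iff_eq_empty] at hemp
    have h1 := happ (F.erase v)
    rw [h, ← hi, hemp, Finset.sup_empty, Nat.bot_eq_zero] at h1
    omega
  refine ⟨w, Finset.mem_of_mem_erase hw, Finset.ne_of_mem_erase hw, i, ?_, hi0⟩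
  rw [hi, ← h, happ, hwi]

end Buchberger

/-! ### The generators of `Ī` -/

section IdealBar

variable {k : Type*} [Field k] {n m : ℕ}

/-- A monomial in `x_1, …, x_n` regarded as a monomial in `x_1, …, x_m`. -/
noncomputable def liftMonomial (hnm : n ≤ m) (a : Fin n →₀ ℕ) : Fin m →₀ ℕ :=
  a.embDomain (Fin.castLEEmb hnm)

theorem liftMonomial_castLE (hnm : n ≤ m) (a : Fin n →₀ ℕ) (i : Fin n) :
    liftMonomial hnm a (Fin.castLE hnm i) = a i :=
  Finsupp.embDomain_apply_self (Fin.castLEEmb hnm) a i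

theorem liftMonomial_of_le (hnm : n ≤ m) (a : Fin n →₀ ℕ) {j : Fin m} (hj : n ≤ (j : ℕ)) :
    liftMonomial hnm a j = 0 := by
  refine Finsupp.embDomain_of_notMem_range _ _ _ ?_
  rintro ⟨i, rfl⟩
  exact absurd i.2 (not_lt.2 hj)

theorem forall_fin_castLE (hnm : n ≤ m) {p : Fin m → Prop} (h1 : ∀ i, p (Fin.castLE hnm i))
    (h2 : ∀ j : Fin m, n ≤ (j : ℕ) → p j) (j : Fin m) : p j := by
  rcases lt_or_ge (j : ℕ) n with h | h
  · exact h1 ⟨j, h⟩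
  · exact h2 j h

theorem liftMonomial_le_iff (hnm : n ≤ m) {a b : Fin n →₀ ℕ} :
    liftMonomial hnm a ≤ liftMonomial hnm b ↔ a ≤ b := by
  constructor
  · intro h i
    simpa only [liftMonomial_castLE] using h (Fin.castLE hnm i)
  · refine fun h => forall_fin_castLE hnm (fun i => ?_) fun j hj => ?_
    · simpa only [liftMonomial_castLE] using h i
    · simp only [liftMonomial_of_le hnm _ hj, le_refl]

theorem ProperlyDivides.liftMonomial_sup (hnm : n ≤ m) {a b c : Fin n →₀ ℕ}
    (h : ProperlyDivides c (a ⊔ b)) :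
    ProperlyDivides (liftMonomial hnm c) (liftMonomial hnm a ⊔ liftMonomial hnm b) := by
  have hsup : liftMonomial hnm a ⊔ liftMonomial hnm b = liftMonomial hnm (a ⊔ b) := by
    ext j
    revert j
    refine forall_fin_castLE hnm (fun i => ?_) fun j hj => ?_
    · simp only [Finsupp.sup_apply, liftMonomial_castLE]
    · simp only [Finsupp.sup_apply, liftMonomial_of_le hnm _ hj, sup_idem]
  rw [hsup]
  refine ⟨(liftMonomial_le_iff hnm).2 h.1, forall_fin_castLE hnm (fun i => ?_) fun j hj => ?_⟩
  · simp only [liftMonomial_castLE]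
    exact h.2 i
  · simp only [liftMonomial_of_le hnm _ hj, ne_eq, not_true_eq_false, false_implies, imp_self,
      and_self]

/-- The additional generator `x_i^{u_i+1} M` of `Ī`. -/
noncomputable def barMonomial (hnm : n ≤ m) (u : Fin n →₀ ℕ) (M : Fin m →₀ ℕ) (i : Fin n) :
    Fin m →₀ ℕ :=
  Finsupp.single (Fin.castLE hnm i) (u i + 1) + M

theorem barMonomial_castLE (hnm : n ≤ m) (u : Fin n →₀ ℕ) {M : Fin m →₀ ℕ}
    (hM : ∀ j : Fin m, (j : ℕ) < n → M j = 0) (i j : Fin n) :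
    barMonomial hnm u M i (Fin.castLE hnm j) = if i = j then u i + 1 else 0 := by
  rw [barMonomial, Finsupp.add_apply, hM _ j.2, add_zero, Finsupp.single_apply]
  simp only [(Fin.castLE_injective hnm).eq_iff]

/-- The monomials generating `Ī` that come with a set `A` of monomial generators of `I`. -/
def barGenerators (hnm : n ≤ m) (u : Fin n →₀ ℕ) (M : Fin m →₀ ℕ) (A : Set (Fin n →₀ ℕ)) :
    Set (Fin m →₀ ℕ) :=
  liftMonomial hnm '' A ∪ Set.range (barMonomial hnm u M)

theorem idealBar_span (hnm : n ≤ m) (u : Fin n →₀ ℕ) (M : Fin m →₀ ℕ) (A : Set (Fin n →₀ ℕ)) :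
    idealBar hnm u (Ideal.span ((fun a => monomial a (1 : k)) '' A)) M =
      Ideal.span ((fun a => monomial a (1 : k)) '' barGenerators hnm u M A) := by
  rw [idealBar, Ideal.map_span, ← Ideal.span_union, barGenerators, Set.image_union,
    Set.image_image, Set.image_image, ← Set.range_comp]
  congr 2
  refine Set.image_congr fun a _ => ?_
  rw [rename_monomial, liftMonomial, Finsupp.embDomain_eq_mapDomain]
  rfl

theorem monomial_mem_span_iff {σ : Type*} {A : Set (σ →₀ ℕ)} {b : σ →₀ ℕ} :
    monomial b (1 : k) ∈ Ideal.span ((fun a => monomial a (1 : k)) '' A) ↔ ∃ a ∈ A, a ≤ b := by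
  classical
  rw [mem_ideal_span_monomial_image, support_monomial, if_neg one_ne_zero]
  simp

theorem mem_of_mem_minGen_span {σ : Type*} {A : Set (σ →₀ ℕ)} {b : σ →₀ ℕ}
    (hb : b ∈ minGen (Ideal.span ((fun a => monomial a (1 : k)) '' A))) : b ∈ A := by
  obtain ⟨a, ha, hab⟩ := monomial_mem_span_iff.1 hb.1
  have h := hb.2 (monomial_mem_span_iff.2 ⟨a, ha, le_rfl⟩) hab
  rwa [le_antisymm h hab]

variable (hnm : n ≤ m) {u : Fin n →₀ ℕ} {M : Fin m →₀ ℕ} {A : Set (Fin n →₀ ℕ)}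

theorem barGenerator_le_liftMonomial
    (hM : ∀ j : Fin m, (j : ℕ) < n → M j = 0) {c : Fin n →₀ ℕ} (hc : c ≤ u) {e : Fin m →₀ ℕ}
    (he : e ∈ barGenerators hnm u M A) (hec : e ≤ liftMonomial hnm c) :
    ∃ a ∈ A, e = liftMonomial hnm a ∧ a ≤ c := by
  rcases he with ⟨a, ha, rfl⟩ | ⟨i, rfl⟩
  · exact ⟨a, ha, rfl, (liftMonomial_le_iff hnm).1 hec⟩
  · have h1 := hec (Fin.castLE hnm i)
    rw [barMonomial_castLE hnm u hM, if_pos rfl, liftMonomial_castLE] at h1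
    have h2 := hc i
    omega

theorem liftMonomial_mem_minGen_iff
    (hM : ∀ j : Fin m, (j : ℕ) < n → M j = 0) {c : Fin n →₀ ℕ} (hc : c ≤ u) :
    liftMonomial hnm c ∈
        minGen (Ideal.span ((fun a => monomial a (1 : k)) '' barGenerators hnm u M A)) ↔
      c ∈ minGen (Ideal.span ((fun a => monomial a (1 : k)) '' A)) := by
  constructor
  · rintro ⟨h1, h2⟩
    obtain ⟨e, he, hec⟩ := monomial_mem_span_iff.1 h1
    obtain ⟨a, ha, rfl, hac⟩ := barGenerator_le_liftMonomial hnm hM hc he hec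
    refine ⟨monomial_mem_span_iff.2 ⟨a, ha, hac⟩, fun b hb hbc => ?_⟩
    obtain ⟨a', ha', hab⟩ := monomial_mem_span_iff.1 hb
    refine (liftMonomial_le_iff hnm).1 (h2 (monomial_mem_span_iff.2
      ⟨_, Or.inl ⟨a', ha', rfl⟩, (liftMonomial_le_iff hnm).2 hab⟩)
      ((liftMonomial_le_iff hnm).2 hbc))
  · intro h
    refine ⟨monomial_mem_span_iff.2
      ⟨_, Or.inl ⟨c, mem_of_mem_minGen_span h, rfl⟩, le_rfl⟩, fun b hb hbc => ?_⟩
    obtain ⟨e, he, heb⟩ := monomial_mem_span_iff.1 hb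
    obtain ⟨a, ha, rfl, hac⟩ := barGenerator_le_liftMonomial hnm hM hc he (heb.trans hbc)
    have hca := h.2 (monomial_mem_span_iff.2 ⟨a, ha, le_rfl⟩) hac
    exact ((liftMonomial_le_iff hnm).2 hca).trans heb

theorem span_barGenerators_ne_top (hA : (0 : Fin n →₀ ℕ) ∉ A)
    (hM : ∀ j : Fin m, (j : ℕ) < n → M j = 0) :
    Ideal.span ((fun a => monomial a (1 : k)) '' barGenerators hnm u M A) ≠ ⊤ := by
  rw [Ideal.ne_top_iff_one]
  intro h
  obtain ⟨e, he, he0⟩ := (monomial_mem_span_iff (b := (0 : Fin m →₀ ℕ))).1 h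
  rcases he with ⟨a, ha, rfl⟩ | ⟨i, rfl⟩
  · have h0 : a = 0 := by
      ext i
      have := he0 (Fin.castLE hnm i)
      rw [liftMonomial_castLE] at this
      simpa using this
    exact hA (h0 ▸ ha)
  · have := he0 (Fin.castLE hnm i)
    rw [barMonomial_castLE hnm u hM, if_pos rfl] at this
    simp at this

/-- Genericity of `I` makes every vertex of a face of the Buchberger complex of `Ī` matter for the
label. Note that `Ī` itself need not be generic: the monomials `x_i^{u_i+1} M` share the factor
`M`. They are harmless, as each is the only generator of its degree in `x_i`. -/
theorem label_erase_ne_label (hA : ∀ a ∈ A, a ≤ u) (hM : ∀ j : Fin m, (j : ℕ) < n → M j = 0)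
    (hgen : IsGeneric (Ideal.span ((fun a => monomial a (1 : k)) '' A)))
    {F : Finset (Fin m →₀ ℕ)}
    (hF : F ∈ buchbergerComplex
      (Ideal.span ((fun a => monomial a (1 : k)) '' barGenerators hnm u M A)))
    {v : Fin m →₀ ℕ} (hv : v ∈ F) : label (F.erase v) ≠ label F := by
  intro hlab
  obtain ⟨w, hw, hwv, i, hi, hi0⟩ := exists_apply_eq_of_label_erase_eq hF hv hlab
  have hvG := mem_of_mem_minGen_span (hF.1 v hv)
  have hwG := mem_of_mem_minGen_span (hF.1 w hw)
  have hvF : v ≤ label F := Finset.le_sup (f := id) hv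
  rcases hvG with ⟨a, ha, rfl⟩ | ⟨j, rfl⟩
  · obtain ⟨i, rfl⟩ : ∃ i', i = Fin.castLE hnm i' := by
      rcases lt_or_ge (i : ℕ) n with h | h
      · exact ⟨⟨i, h⟩, rfl⟩
      · rw [liftMonomial_of_le hnm a h] at hi0
        exact absurd hi0 (lt_irrefl 0)
    rw [liftMonomial_castLE] at hi hi0
    rcases hwG with ⟨b, hb, rfl⟩ | ⟨j, rfl⟩
    · rw [liftMonomial_castLE] at hi
      obtain ⟨c, hc, -, -, hdiv⟩ := hgen a
        ((liftMonomial_mem_minGen_iff hnm hM (hA a ha)).1 (hF.1 _ hv)) b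
        ((liftMonomial_mem_minGen_iff hnm hM (hA b hb)).1 (hF.1 _ hw))
        (fun e => hwv (by rw [e])) ⟨i, hi, hi0⟩
      refine hF.2 (liftMonomial hnm c) ((liftMonomial_mem_minGen_iff hnm hM
        (hA c (mem_of_mem_minGen_span hc))).2 hc) ?_
      exact (hdiv.liftMonomial_sup hnm).trans_le
        (sup_le hvF (Finset.le_sup (f := id) hw))
    · rw [barMonomial_castLE hnm u hM] at hi
      have hau := hA a ha i
      split_ifs at hi with hji
      · subst hji
        omega
      · omega
  · -- Only `x_j^{u_j+1} M` itself attains the degree `u_j + 1` in the variable `x_j`.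
    have hsub : label (F.erase (barMonomial hnm u M j)) (Fin.castLE hnm j) ≤ u j := by
      have happ : ∀ G : Finset (Fin m →₀ ℕ), label G (Fin.castLE hnm j) =
          G.sup fun w => w (Fin.castLE hnm j) := fun G =>
        Finset.apply_sup_eq_sup_comp (fun a : Fin m →₀ ℕ => a (Fin.castLE hnm j))
          (fun _ _ => rfl) rfl
      rw [happ]
      refine Finset.sup_le fun x hx => ?_
      rcases mem_of_mem_minGen_span (hF.1 x (Finset.mem_of_mem_erase hx)) with
        ⟨a, ha, rfl⟩ | ⟨l, rfl⟩
      · rw [liftMonomial_castLE]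
        exact hA a ha j
      · rw [barMonomial_castLE hnm u hM, if_neg]
        · exact Nat.zero_le _
        · rintro rfl
          exact Finset.ne_of_mem_erase hx rfl
    have h1 := hvF (Fin.castLE hnm j)
    rw [barMonomial_castLE hnm u hM, if_pos rfl, ← hlab] at h1
    omega

end IdealBar

end MonomialRes

theorem mainTheorem5 {k : Type*} [Field k] {n m : ℕ} (hnm : n < m)
    (u : Fin n →₀ ℕ) (I : Ideal (MvPolynomial (Fin n) k))
    (hI : ∃ A : Set (Fin n →₀ ℕ), (∀ a ∈ A, a ≤ u) ∧
      I = Ideal.span ((fun a : Fin n →₀ ℕ => MvPolynomial.monomial a (1 : k)) '' A))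
    (hproper : I ≠ ⊤)
    (M : Fin m →₀ ℕ) (hM : ∀ j : Fin m, (j : ℕ) < n → M j = 0)
    (hgen : MonomialRes.IsGeneric I) :
    MonomialRes.SupportsMinimalFreeResolution
        (MonomialRes.buchbergerComplex (MonomialRes.idealBar hnm.le u I M))
        (MonomialRes.idealBar hnm.le u I M) ∧
      MonomialRes.SupportsMinimalFreeResolution
        (MonomialRes.scarfComplex (MonomialRes.idealBar hnm.le u I M))
        (MonomialRes.idealBar hnm.le u I M) := by
  obtain ⟨A, hA, rfl⟩ := hI
  have h0 : (0 : Fin n →₀ ℕ) ∉ A := fun h =>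
    hproper ((Ideal.eq_top_iff_one _).2 (Ideal.subset_span ⟨0, h, rfl⟩))
  rw [MonomialRes.idealBar_span]
  have hJ := MonomialRes.span_barGenerators_ne_top (k := k) (u := u) hnm.le h0 hM
  have hlabel := fun F (hF : F ∈ MonomialRes.buchbergerComplex (Ideal.span
      ((fun a => monomial a (1 : k)) '' MonomialRes.barGenerators hnm.le u M A))) v hv =>
    MonomialRes.label_erase_ne_label hnm.le hA hM hgen hF (v := v) hv
  -- The Scarf complex equals the Buchberger complex, so a single resolution is needed.
  have hBu : MonomialRes.SupportsMinimalFreeResolution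
      (MonomialRes.buchbergerComplex (Ideal.span
        ((fun a => monomial a (1 : k)) '' MonomialRes.barGenerators hnm.le u M A)))
      (Ideal.span ((fun a => monomial a (1 : k)) '' MonomialRes.barGenerators hnm.le u M A)) :=
    ⟨MonomialRes.isGradedFreeResolution_buchbergerComplex hJ rfl,
      MonomialRes.range_cellularD_le hlabel⟩
  rw [le_antisymm (MonomialRes.scarfComplex_le_buchbergerComplex _)
    (MonomialRes.buchbergerComplex_le_scarfComplex hlabel)]
  exact ⟨hBu, hBu⟩
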